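/- **Proposition 2.1 (characterization of unmixed $f$-ideals).** Let $K$ be a field, $S=K[x_1,\dots,x_n]$, and $[n]=\{1,\dots,n\}$. For a square-free monomial $u=x_{i_1}\cdots x_{i_k}$ put $\sigma(u)=\{i_1,\dots,i_k\}$. For a monomial ideal $I$ of $S$ let $G(I)$ be its minimal set of monomial generators, let $sm(I)$ be the set of square-free monomials in $I$, and let $sm(S)_d$ be the set of all square-free monomials of degree $d$. A simplicial complex on $[n]$ is a (possibly empty) family of subsets of $[n]$ closed under taking subsets; its dimension is the maximum of $|F|-1$ over its faces $F$ ($-\infty$ if there are none), and its $f$-vector records, for each $k\ge 0$, the number of faces with $k$ elements. For a family $\mathcal A$ of subsets of $[n]$ let $\langle\mathcal A\rangle$ be the complex of all subsets of members of $\mathcal A$. The Alexander dual of a complex $\Delta$ is $\Delta^\vee=\{F\subseteq[n] : [n]\setminus F\notin\Delta\}$. A complex is a $d$-flag complex if every minimal non-face (minimal among the subsets of $[n]$ that are not faces) has exactly $d$ elements. Let $\delta_{\mathcal F}(I)=\langle\sigma(u) : u\in G(I)\rangle$ be the facet complex and $\delta_{\mathcal N}(I)=\{\sigma(g) : g\in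 sm(S)\setminus sm(I)\}$ the Stanley–Reisner complex of a square-free monomial ideal $I$. The ideal $I$ is an $f$-ideal if $\delta_{\mathcal F}(I)$ and $\delta_{\mathcal N}(I)$ have the same $f$-vector, and it is unmixed if every associated prime of $S/I$ has the same height as $I$. Let $I$ be a square-free monomial ideal of $S$ of degree $d$, i.e. all elements of $G(I)$ have degree $d$. Then $I$ is an unmixed $f$-ideal if and only if the following three conditions hold: 1. $|G(I)|=\frac12\binom nd$; 2. $\dim \delta_{\mathcal F}(I)^\vee=n-d-1$; 3. $\langle\sigma(u) : u\in sm(S)_d\setminus G(I)\rangle$ is a $d$-flag complex. -/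

import Mathlib

/-! Square-free monomial ideals in `K[x_1, …, x_n]`. The set `[n]` is modelled by `Fin n`. -/

namespace FIdeal

open MvPolynomial

/-- A monomial of `K[x_1, …, x_n]` (with coefficient one). -/
def IsMonomial {n : ℕ} {K : Type*} [Field K] (u : MvPolynomial (Fin n) K) : Prop :=
  ∃ e : Fin n →₀ ℕ, u = monomial e 1

/-- A square-free monomial: every variable occurs with exponent at most one. -/
def IsSqfreeMonomial {n : ℕ} {K : Type*} [Field K] (u : MvPolynomial (Fin n) K) : Prop :=
  ∃ e : Fin n →₀ ℕ, (∀ i, e i ≤ 1) ∧ u = monomial e 1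

/-- An ideal is a square-free monomial ideal if it is generated by square-free monomials. -/
def IsSqfreeMonomialIdeal {n : ℕ} {K : Type*} [Field K]
    (I : Ideal (MvPolynomial (Fin n) K)) : Prop :=
  ∃ A : Set (MvPolynomial (Fin n) K), (∀ u ∈ A, IsSqfreeMonomial u) ∧ I = Ideal.span A

/-- `sm(I)`: the set of square-free monomials in `I`. -/
def sm {n : ℕ} {K : Type*} [Field K] (I : Ideal (MvPolynomial (Fin n) K)) :
    Set (MvPolynomial (Fin n) K) :=
  {u | u ∈ I ∧ IsSqfreeMonomial u}

/-- `sm(S)_d`: the set of all square-free monomials of degree `d`. -/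
def smDeg (n : ℕ) (K : Type*) [Field K] (d : ℕ) : Set (MvPolynomial (Fin n) K) :=
  {u | u ∈ sm (⊤ : Ideal (MvPolynomial (Fin n) K)) ∧ u.totalDegree = d}

/-- `G(I)`: the minimal set of monomial generators of a monomial ideal `I`, that is, the
monomials of `I` which are minimal with respect to divisibility. -/
def minGens {n : ℕ} {K : Type*} [Field K] (I : Ideal (MvPolynomial (Fin n) K)) :
    Set (MvPolynomial (Fin n) K) :=
  {u | u ∈ I ∧ IsMonomial u ∧ ∀ v ∈ I, IsMonomial v → v ∣ u → v = u}

/-- A square-free monomial ideal of degree `d`: all its minimal monomial generators have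
degree `d`. -/
def IsSqfreeMonomialIdealOfDegree {n : ℕ} {K : Type*} [Field K]
    (I : Ideal (MvPolynomial (Fin n) K)) (d : ℕ) : Prop :=
  IsSqfreeMonomialIdeal I ∧ ∀ u ∈ minGens I, u.totalDegree = d

/-- The map `σ`, which sends `x_{i_1} ⋯ x_{i_k}` to `{i_1, …, i_k}`. -/
noncomputable def sigma {n : ℕ} {K : Type*} [Field K] (u : MvPolynomial (Fin n) K) :
    Finset (Fin n) :=
  u.vars

/-- Simplicial complexes on the vertex set `[n]`: collections of subsets of `[n]` which are closed
under taking subsets. The empty set is a face of every complex other than the void complex, which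
has no face at all; not every element of `[n]` has to be a face. (Mathlib's abstract simplicial
complexes leave out the empty face, which matters for the Alexander dual.) -/
abbrev Complex (n : ℕ) : Type := LowerSet (Finset (Fin n))

/-- The complex generated by a collection of subsets of `[n]`. -/
def generatedBy {n : ℕ} (A : Set (Finset (Fin n))) : Complex n := lowerClosure A

/-- Entry `k` of the `f`-vector is `f_{k-1}`, the number of faces with `k` elements, i.e. of
dimension `k - 1`. -/
noncomputable def fVector {n : ℕ} (Δ : Complex n) (k : ℕ) : ℕ :=
  {F : Finset (Fin n) | F ∈ Δ ∧ F.card = k}.ncard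

open Classical in
/-- The dimension of a complex: the maximum of `|F| - 1` over all faces `F`
(and `⊥`, i.e. `-∞`, for the void complex). -/
noncomputable def dim {n : ℕ} (Δ : Complex n) : WithBot ℤ :=
  (Finset.univ.filter (fun F : Finset (Fin n) => F ∈ Δ)).sup
    (fun F => (((F.card : ℤ) - 1 : ℤ) : WithBot ℤ))

/-- The Alexander dual: its faces are the complements in `[n]` of the non-faces. -/
def alexanderDual {n : ℕ} (Δ : Complex n) : Complex n where
  carrier := {F | Fᶜ ∉ Δ}
  lower' := fun _ _ hba ha hb => ha (Δ.lower (Finset.compl_subset_compl.mpr hba) hb)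

/-- A `d`-flag complex: all minimal non-faces have exactly `d` elements. -/
def IsFlag {n : ℕ} (d : ℕ) (Δ : Complex n) : Prop :=
  ∀ F : Finset (Fin n), Minimal (fun F' => F' ∉ Δ) F → F.card = d

/-- The facet complex `δ_F(I)`, generated by `σ(G(I))`. -/
noncomputable def facetComplex {n : ℕ} {K : Type*} [Field K]
    (I : Ideal (MvPolynomial (Fin n) K)) : Complex n :=
  generatedBy (sigma '' minGens I)

theorem exists_sqfree_of_subset {n : ℕ} {K : Type*} [Field K] {g : MvPolynomial (Fin n) K}
    (hg : IsSqfreeMonomial g) {F : Finset (Fin n)} (hF : F ⊆ sigma g) :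
    ∃ h : MvPolynomial (Fin n) K, IsSqfreeMonomial h ∧ sigma h = F ∧ h ∣ g := by
  obtain ⟨e, he, rfl⟩ := hg
  refine ⟨monomial (e.filter (· ∈ F)) 1, ⟨_, fun i => ?_, rfl⟩, ?_, ?_⟩
  · rw [Finsupp.filter_apply]
    split_ifs
    · exact he i
    · exact Nat.zero_le 1
  · unfold sigma at hF ⊢
    rw [vars_monomial one_ne_zero] at hF ⊢
    ext i
    simp only [Finsupp.support_filter, Finset.mem_filter]
    exact ⟨fun h => h.2, fun h => ⟨hF h, h⟩⟩
  · refine monomial_dvd_monomial.mpr ⟨Or.inr fun i => ?_, dvd_rfl⟩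
    rw [Finsupp.filter_apply]
    split_ifs
    · exact le_rfl
    · exact Nat.zero_le _

/-- The Stanley–Reisner complex `δ_N(I) = {σ(g) | g ∈ sm(S) \ sm(I)}`. -/
noncomputable def stanleyReisnerComplex {n : ℕ} {K : Type*} [Field K]
    (I : Ideal (MvPolynomial (Fin n) K)) : Complex n where
  carrier := sigma '' (sm (⊤ : Ideal (MvPolynomial (Fin n) K)) \ sm I)
  lower' := by
    rintro _ F hF ⟨g, ⟨hg, hgI⟩, rfl⟩
    obtain ⟨h, hh, rfl, hdvd⟩ := exists_sqfree_of_subset hg.2 hF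
    exact ⟨h, ⟨⟨Submodule.mem_top, hh⟩,
      fun hI => hgI ⟨Ideal.mem_of_dvd I hdvd hI.1, hg.2⟩⟩, rfl⟩

/-- An `f`-ideal: the facet complex and the Stanley–Reisner complex have the same `f`-vector. -/
def IsFIdeal {n : ℕ} {K : Type*} [Field K] (I : Ideal (MvPolynomial (Fin n) K)) : Prop :=
  fVector (facetComplex I) = fVector (stanleyReisnerComplex I)

/-- An ideal `I` of a ring `S` is unmixed if all associated primes of `S ⧸ I` have the same
height, namely that of `I`. -/
def IsUnmixed {S : Type*} [CommRing S] (I : Ideal S) : Prop :=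
  ∀ P ∈ associatedPrimes S (S ⧸ I), P.height = I.height

end FIdeal

/-! Everything is read off from Δ = δ_N(I): the supports of G(I) are its minimal non-faces, all of
size d, and they generate Γ = δ_F(I). Below size d every set is a face of Δ, above d none is a face
of Γ, and in size d the two complexes are complementary. So the f-vectors agree iff |G(I)| is half
of C(n,d), Γ contains every set with fewer than d elements, and Δ has no face with more than d. The
first two conditions are 1 and 2, up to a non-face of Γ of size d
(`fVector_generatedBy_minimal_eq_iff`). The associated primes of S/I are generated by the
complements of facets of Δ, so unmixed means pure (`isUnmixed_iff`). For an f-ideal Δ has a face of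
size d, so purity says that Δ is generated by its d-faces. As these are the d-sets outside σ(G(I)),
this is condition 3 (`equal_fVector_and_pure_iff`). -/

namespace FIdeal

open MvPolynomial

/-! ### Primes generated by variables -/

section VariableIdeals

variable {ι K : Type*} [Field K]

/-- The ideal generated by the variables with index in `W`. -/
noncomputable def varIdeal (K : Type*) [Field K] (W : Set ι) : Ideal (MvPolynomial ι K) :=
  Ideal.span (X '' W)

theorem X_mem_varIdeal_iff {W : Set ι} {i : ι} :
    (X i : MvPolynomial ι K) ∈ varIdeal K W ↔ i ∈ W := by
  classical
  rw [varIdeal, mem_ideal_span_X_image]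
  simp [support_X, Finsupp.single_apply]

theorem varIdeal_le_iff {W : Set ι} {P : Ideal (MvPolynomial ι K)} :
    varIdeal K W ≤ P ↔ ∀ i ∈ W, X i ∈ P := by
  rw [varIdeal, Ideal.span_le, Set.image_subset_iff]
  rfl

theorem varIdeal_le_varIdeal_iff {W W' : Set ι} :
    varIdeal K W ≤ varIdeal K W' ↔ W ⊆ W' := by
  simp_rw [varIdeal_le_iff, X_mem_varIdeal_iff, Set.subset_def]

/-- Killing the variables in `W` is an endomorphism of a domain; its kernel is no larger because the
quotient map factors through it. -/
instance isPrime_varIdeal (W : Set ι) : (varIdeal K W).IsPrime := by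
  classical
  let φ : MvPolynomial ι K →ₐ[K] MvPolynomial ι K := aeval fun i => if i ∈ W then 0 else X i
  suffices h : varIdeal K W = RingHom.ker φ by
    rw [h]; exact RingHom.ker_isPrime _
  refine le_antisymm (varIdeal_le_iff.mpr fun i hi => ?_) fun f hf => ?_
  · simp [RingHom.mem_ker, φ, hi]
  · have h : (Ideal.Quotient.mkₐ K (varIdeal K W)).comp φ =
        Ideal.Quotient.mkₐ K (varIdeal K W) := by
      ext i
      by_cases hi : i ∈ W
      · have : Ideal.Quotient.mk (varIdeal K W) (X i) = 0 :=
          Ideal.Quotient.eq_zero_iff_mem.mpr (X_mem_varIdeal_iff.mpr hi)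
        simp [φ, hi, this]
      · simp [φ, hi]
    have h' := DFunLike.congr_fun h f
    rw [AlgHom.comp_apply, RingHom.mem_ker.mp hf, map_zero] at h'
    exact Ideal.Quotient.eq_zero_iff_mem.mp h'.symm

/-- Krull's height theorem bounds from above; adding the variables one at a time gives a strict
chain of primes. -/
theorem height_varIdeal [Finite ι] (W : Finset ι) : (varIdeal K (W : Set ι)).height = W.card := by
  classical
  apply le_antisymm
  · have h : varIdeal K (W : Set ι) ∈
        (Ideal.span (X '' (W : Set ι)) : Ideal (MvPolynomial ι K)).minimalPrimes := by
      change _ ∈ (varIdeal K (W : Set ι)).minimalPrimes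
      rw [Ideal.minimalPrimes_eq_subsingleton_self]
      rfl
    refine (Ideal.height_le_card_of_mem_minimalPrimes_span (W.finite_toSet.image _) h).trans ?_
    have := Set.ncard_image_le (f := (X : ι → MvPolynomial ι K)) W.finite_toSet
    rw [Set.ncard_coe_finset] at this
    exact_mod_cast this
  · induction W using Finset.induction_on with
    | empty => simp
    | insert a W ha ih =>
      have hlt : varIdeal K (W : Set ι) < varIdeal K ((insert a W : Finset ι) : Set ι) := by
        rw [lt_iff_le_not_ge, varIdeal_le_varIdeal_iff, varIdeal_le_varIdeal_iff]
        exact ⟨by simp, fun h => ha (by simpa using h (by simp : a ∈ _))⟩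
      rw [Finset.card_insert_of_notMem ha, Nat.cast_add, Nat.cast_one]
      exact (add_le_add_left ih 1).trans (Ideal.height_add_one_le_of_lt_of_isPrime hlt)

end VariableIdeals

/-! ### Square-free monomials and their supports -/

section Monomials

variable {n : ℕ} {K : Type*} [Field K]

/-- The product of the variables with index in `A`. -/
noncomputable def sqfreeMonomial (K : Type*) [Field K] (A : Finset (Fin n)) :
    MvPolynomial (Fin n) K :=
  monomial (Finsupp.indicator A fun _ _ => 1) 1

theorem sqfreeMonomial_eq_prod (A : Finset (Fin n)) :
    sqfreeMonomial K A = ∏ i ∈ A, X i := by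
  rw [sqfreeMonomial, monomial_eq, C_1, one_mul]
  rw [Finsupp.prod_of_support_subset _ (Finsupp.support_indicator_subset _ _) _ (by simp)]
  exact Finset.prod_congr rfl fun i hi => by simp [Finsupp.indicator_of_mem hi]

theorem support_indicator_one (A : Finset (Fin n)) :
    (Finsupp.indicator A fun _ _ => 1 : Fin n →₀ ℕ).support = A := by
  ext i
  simp [Finsupp.indicator_apply]

theorem eq_indicator_support {e : Fin n →₀ ℕ} (he : ∀ i, e i ≤ 1) :
    e = Finsupp.indicator e.support fun _ _ => 1 := by
  ext i
  have := he i
  by_cases h : e i = 0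
  · simp [Finsupp.indicator_apply, h]
  · simp [Finsupp.indicator_apply, h]
    omega

theorem sigma_sqfreeMonomial (A : Finset (Fin n)) : sigma (sqfreeMonomial K A) = A := by
  rw [sigma, sqfreeMonomial, vars_monomial one_ne_zero, support_indicator_one]

theorem sqfreeMonomial_injective :
    Function.Injective (sqfreeMonomial K : Finset (Fin n) → MvPolynomial (Fin n) K) :=
  Function.LeftInverse.injective sigma_sqfreeMonomial

theorem totalDegree_sqfreeMonomial (A : Finset (Fin n)) :
    (sqfreeMonomial K A).totalDegree = A.card := by
  rw [sqfreeMonomial, totalDegree_monomial _ one_ne_zero, Finsupp.sum, support_indicator_one,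
    Finset.card_eq_sum_ones]
  exact Finset.sum_congr rfl fun i hi => by simp [Finsupp.indicator_of_mem hi]

theorem isSqfreeMonomial_iff {u : MvPolynomial (Fin n) K} :
    IsSqfreeMonomial u ↔ ∃ A, sqfreeMonomial K A = u := by
  constructor
  · rintro ⟨e, he, rfl⟩
    exact ⟨e.support, by rw [sqfreeMonomial, ← eq_indicator_support he]⟩
  · rintro ⟨A, rfl⟩
    refine ⟨_, fun i => ?_, rfl⟩
    rw [Finsupp.indicator_apply]
    split_ifs <;> simp

theorem sm_top_eq : sm (⊤ : Ideal (MvPolynomial (Fin n) K)) = Set.range (sqfreeMonomial K) := by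
  ext u
  simp [sm, isSqfreeMonomial_iff]

theorem smDeg_eq (d : ℕ) : smDeg n K d = sqfreeMonomial K '' {A | A.card = d} := by
  ext u
  simp only [smDeg, sm_top_eq, Set.mem_ofPred_eq, Set.mem_range, Set.mem_image]
  constructor
  · rintro ⟨⟨A, rfl⟩, h⟩
    exact ⟨A, by rwa [totalDegree_sqfreeMonomial] at h, rfl⟩
  · rintro ⟨A, h, rfl⟩
    exact ⟨⟨A, rfl⟩, by rwa [totalDegree_sqfreeMonomial]⟩

theorem sqfreeMonomial_dvd_monomial (e : Fin n →₀ ℕ) :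
    sqfreeMonomial K e.support ∣ monomial e 1 := by
  refine monomial_dvd_monomial.mpr ⟨Or.inr fun i => ?_, dvd_rfl⟩
  rw [Finsupp.indicator_apply]
  split_ifs with h
  · exact Nat.one_le_iff_ne_zero.mpr (Finsupp.mem_support_iff.mp h)
  · exact Nat.zero_le _

theorem sqfreeMonomial_dvd_of_subset {A B : Finset (Fin n)} (h : A ⊆ B) :
    sqfreeMonomial K A ∣ sqfreeMonomial K B := by
  rw [sqfreeMonomial_eq_prod, sqfreeMonomial_eq_prod]
  exact Finset.prod_dvd_prod_of_subset _ _ _ h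

variable {I : Ideal (MvPolynomial (Fin n) K)}

theorem sqfreeMonomial_mem_of_subset {A B : Finset (Fin n)} (h : A ⊆ B)
    (hA : sqfreeMonomial K A ∈ I) : sqfreeMonomial K B ∈ I :=
  I.mem_of_dvd (sqfreeMonomial_dvd_of_subset h) hA

/-- A square-free generator divides a monomial iff it divides the product of the variables occurring
in it. -/
theorem IsSqfreeMonomialIdeal.mem_iff (hI : IsSqfreeMonomialIdeal I)
    {f : MvPolynomial (Fin n) K} :
    f ∈ I ↔ ∀ m ∈ f.support, sqfreeMonomial K m.support ∈ I := by
  obtain ⟨A, hA, rfl⟩ := hI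
  have hA' : A = (fun s => monomial s (1 : K)) ''
      {e : Fin n →₀ ℕ | (∀ i, e i ≤ 1) ∧ monomial e 1 ∈ A} := by
    ext u
    constructor
    · intro hu
      obtain ⟨e, he, rfl⟩ := hA u hu
      exact ⟨e, ⟨he, hu⟩, rfl⟩
    · rintro ⟨e, ⟨-, hu⟩, rfl⟩
      exact hu
  rw [hA', mem_ideal_span_monomial_image]
  refine forall₂_congr fun m _ => ?_
  classical
  rw [mem_ideal_span_monomial_image, sqfreeMonomial, support_monomial, if_neg one_ne_zero]
  simp only [Finset.mem_singleton, forall_eq]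
  refine exists_congr fun s => and_congr_right fun hs => ?_
  refine forall_congr' fun i => ?_
  have := hs.1 i
  simp only [Finsupp.indicator_apply, Finsupp.mem_support_iff, dite_eq_ite]
  split_ifs <;> omega

theorem IsSqfreeMonomialIdeal.minGens_eq (hI : IsSqfreeMonomialIdeal I) :
    minGens I = sqfreeMonomial K '' {A | Minimal (fun A => sqfreeMonomial K A ∈ I) A} := by
  have mem_support {e : Fin n →₀ ℕ} (h : monomial e (1 : K) ∈ I) :
      sqfreeMonomial K e.support ∈ I :=
    hI.mem_iff.mp h e (by simp)
  ext u
  constructor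
  · rintro ⟨hu, ⟨e, rfl⟩, hmin⟩
    have he := hmin _ (mem_support hu) ⟨_, rfl⟩ (sqfreeMonomial_dvd_monomial e)
    refine ⟨e.support, ⟨mem_support hu, fun B hB hBe => ?_⟩, he⟩
    have := hmin _ hB ⟨_, rfl⟩ (he ▸ sqfreeMonomial_dvd_of_subset hBe)
    rw [← he] at this
    exact (sqfreeMonomial_injective this).ge
  · rintro ⟨A, hA, rfl⟩
    replace hA : Minimal (fun A => sqfreeMonomial K A ∈ I) A := hA
    refine ⟨hA.prop, ⟨_, rfl⟩, ?_⟩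
    rintro _ hv ⟨e, rfl⟩ hdvd
    have hle := (monomial_dvd_monomial.mp hdvd).1.resolve_left one_ne_zero
    have hle1 : ∀ i, e i ≤ 1 := fun i => (hle i).trans <| by
      rw [Finsupp.indicator_apply]; split_ifs <;> simp
    have hsub : e.support ⊆ A := by
      have := Finsupp.support_mono hle
      rwa [support_indicator_one] at this
    rw [← (hA.eq_of_le (mem_support hv) hsub)]
    rw [sqfreeMonomial, ← eq_indicator_support hle1]

theorem mem_stanleyReisnerComplex {F : Finset (Fin n)} :
    F ∈ stanleyReisnerComplex I ↔ sqfreeMonomial K F ∉ I := by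
  change F ∈ sigma '' (sm (⊤ : Ideal (MvPolynomial (Fin n) K)) \ sm I) ↔ _
  rw [sm_top_eq]
  constructor
  · rintro ⟨_, ⟨⟨A, rfl⟩, h⟩, rfl⟩ hF
    rw [sigma_sqfreeMonomial] at hF
    exact h ⟨hF, isSqfreeMonomial_iff.mpr ⟨A, rfl⟩⟩
  · exact fun h => ⟨_, ⟨⟨F, rfl⟩, fun h' => h h'.1⟩, sigma_sqfreeMonomial F⟩

theorem mem_generatedBy {A : Set (Finset (Fin n))} {F : Finset (Fin n)} :
    F ∈ generatedBy A ↔ ∃ B ∈ A, F ⊆ B :=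
  Iff.rfl

theorem sigma_image_sqfreeMonomial_image (A : Set (Finset (Fin n))) :
    sigma '' (sqfreeMonomial K '' A) = A := by
  simp [Set.image_image, sigma_sqfreeMonomial]

end Monomials

/-! ### Associated primes and purity -/

section Unmixed

variable {n : ℕ} {K : Type*} [Field K] {I : Ideal (MvPolynomial (Fin n) K)}

/-- The prime ideal generated by the variables outside `F`. -/
noncomputable abbrev facePrime (K : Type*) [Field K] (F : Finset (Fin n)) :
    Ideal (MvPolynomial (Fin n) K) :=
  varIdeal K ((Fᶜ : Finset (Fin n)) : Set (Fin n))

theorem height_facePrime (F : Finset (Fin n)) : (facePrime K F).height = (n - F.card : ℕ) := by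
  rw [height_varIdeal, Finset.card_compl, Fintype.card_fin]

theorem facePrime_le_facePrime_iff {F F' : Finset (Fin n)} :
    facePrime K F ≤ facePrime K F' ↔ F' ⊆ F := by
  rw [varIdeal_le_varIdeal_iff, Finset.coe_subset, Finset.compl_subset_compl]

theorem exists_maximal_ge {Δ : Complex n} {F : Finset (Fin n)} (hF : F ∈ Δ) :
    ∃ F', F ⊆ F' ∧ Maximal (· ∈ Δ) F' :=
  (Set.toFinite {F | F ∈ Δ}).exists_le_maximal hF

theorem mem_facePrime_iff {F : Finset (Fin n)} {f : MvPolynomial (Fin n) K} :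
    f ∈ facePrime K F ↔ ∀ m ∈ f.support, ¬ m.support ⊆ F := by
  rw [facePrime, varIdeal, mem_ideal_span_X_image]
  simp [Finset.not_subset, and_comm]

theorem IsSqfreeMonomialIdeal.mem_iff_forall_facePrime (hI : IsSqfreeMonomialIdeal I)
    {f : MvPolynomial (Fin n) K} :
    f ∈ I ↔ ∀ F, Maximal (· ∈ stanleyReisnerComplex I) F → f ∈ facePrime K F := by
  rw [hI.mem_iff]
  constructor
  · intro h F hF
    rw [mem_facePrime_iff]
    exact fun m hm hmF => mem_stanleyReisnerComplex.mp hF.prop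
      (sqfreeMonomial_mem_of_subset hmF (h m hm))
  · intro h m hm
    by_contra hmI
    obtain ⟨F, hmF, hF⟩ := exists_maximal_ge (mem_stanleyReisnerComplex.mpr hmI)
    exact mem_facePrime_iff.mp (h F hF) m hm hmF

/-- The variables outside `P` form a face: otherwise their product lies in `I ≤ P`, and so does one
of them. Any facet containing this face works. -/
theorem exists_facePrime_le_of_isPrime {P : Ideal (MvPolynomial (Fin n) K)} [hP : P.IsPrime]
    (h : I ≤ P) : ∃ F, Maximal (· ∈ stanleyReisnerComplex I) F ∧ facePrime K F ≤ P := by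
  classical
  let F : Finset (Fin n) := Finset.univ.filter fun i => (X i : MvPolynomial (Fin n) K) ∉ P
  have hF : F ∈ stanleyReisnerComplex I := by
    rw [mem_stanleyReisnerComplex]
    intro hFI
    have := h hFI
    rw [sqfreeMonomial_eq_prod, hP.prod_mem_iff] at this
    obtain ⟨i, hi, hiP⟩ := this
    exact (Finset.mem_filter.mp hi).2 hiP
  obtain ⟨F', hFF', hF'⟩ := exists_maximal_ge hF
  refine ⟨F', hF', varIdeal_le_iff.mpr fun i hi => ?_⟩
  by_contra hiP
  exact (Finset.mem_compl.mp hi) (hFF' (by simp [F, hiP]))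

theorem IsSqfreeMonomialIdeal.facePrime_mem_associatedPrimes (hI : IsSqfreeMonomialIdeal I)
    {F : Finset (Fin n)} (hF : Maximal (· ∈ stanleyReisnerComplex I) F) :
    facePrime K F ∈ associatedPrimes _ (MvPolynomial (Fin n) K ⧸ I) := by
  apply Module.associatedPrimes.minimalPrimes_annihilator_subset_associatedPrimes
  rw [Ideal.annihilator_quotient]
  refine ⟨⟨inferInstance, fun f hf => hI.mem_iff_forall_facePrime.mp hf F hF⟩, ?_⟩
  rintro Q ⟨hQ, hIQ⟩ hQF
  obtain ⟨F', hF', hle⟩ := exists_facePrime_le_of_isPrime hIQ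
  rw [hF.eq_of_le hF'.prop (facePrime_le_facePrime_iff.mp (hle.trans hQF))]
  exact hle

theorem IsSqfreeMonomialIdeal.exists_eq_facePrime (hI : IsSqfreeMonomialIdeal I)
    {P : Ideal (MvPolynomial (Fin n) K)}
    (hP : P ∈ associatedPrimes _ (MvPolynomial (Fin n) K ⧸ I)) :
    ∃ F, Maximal (· ∈ stanleyReisnerComplex I) F ∧ P = facePrime K F := by
  classical
  obtain ⟨hP, x, hx⟩ := Submodule.isAssociatedPrime_iff.mp hP
  obtain ⟨f, rfl⟩ := Ideal.Quotient.mk_surjective x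
  let s : Finset (Finset (Fin n)) := Finset.univ.filter fun F =>
    Maximal (· ∈ stanleyReisnerComplex I) F ∧ f ∉ facePrime K F
  -- Here P = (I : f), and intersecting over facets leaves only the facet primes that miss f.
  have hmem (g : MvPolynomial (Fin n) K) : g ∈ P ↔ ∀ F ∈ s, g ∈ facePrime K F := by
    rw [hx, Submodule.mem_colon_singleton, Submodule.mem_bot]
    change Ideal.Quotient.mk I (g * f) = 0 ↔ _
    rw [Ideal.Quotient.eq_zero_iff_mem, hI.mem_iff_forall_facePrime]
    simp only [s, Finset.mem_filter, Finset.mem_univ, true_and, and_imp]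
    refine forall₂_congr fun F _ => ?_
    rw [(isPrime_varIdeal _).mul_mem_iff_mem_or_mem]
    tauto
  have hinf : s.inf (facePrime K) ≤ P := fun g hg =>
    (hmem g).mpr fun F hF => Finset.inf_le (f := facePrime K) hF hg
  obtain ⟨F, hF, hle⟩ := hP.inf_le'.mp hinf
  exact ⟨F, (Finset.mem_filter.mp hF).2.1, le_antisymm (fun g hg => (hmem g).mp hg F hF) hle⟩

theorem IsSqfreeMonomialIdeal.isUnmixed_iff (hI : IsSqfreeMonomialIdeal I) :
    IsUnmixed I ↔ ∀ F F', Maximal (· ∈ stanleyReisnerComplex I) F →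
      Maximal (· ∈ stanleyReisnerComplex I) F' → F.card = F'.card := by
  constructor
  · intro h F F' hF hF'
    have h1 := h _ (hI.facePrime_mem_associatedPrimes hF)
    have h2 := h _ (hI.facePrime_mem_associatedPrimes hF')
    rw [← h2, height_facePrime, height_facePrime, Nat.cast_inj] at h1
    have := card_finset_fin_le F
    have := card_finset_fin_le F'
    omega
  · intro h P hP
    obtain ⟨F, hF, rfl⟩ := hI.exists_eq_facePrime hP
    refine le_antisymm ?_ (Ideal.height_mono fun f hf => hI.mem_iff_forall_facePrime.mp hf F hF)
    rw [Ideal.height_eq_inf_minimalPrimes (I := I)]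
    refine le_iInf₂ fun J hJ => ?_
    have := hJ.1.1
    obtain ⟨F', hF', hle⟩ := exists_facePrime_le_of_isPrime hJ.1.2
    refine le_trans ?_ (Ideal.height_mono hle)
    rw [height_facePrime, height_facePrime, h F F' hF hF']

end Unmixed

/-! ### Face counting, duality and flag complexes -/

section Complexes

variable {n : ℕ}

theorem fVector_eq_choose_iff {Δ : Complex n} {k : ℕ} :
    fVector Δ k = n.choose k ↔ ∀ F : Finset (Fin n), F.card = k → F ∈ Δ := by
  have hc : {F : Finset (Fin n) | F.card = k}.ncard = n.choose k := by
    have h := Finset.card_powersetCard k (Finset.univ : Finset (Fin n))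
    rw [Finset.card_univ, Fintype.card_fin] at h
    rw [← h, ← Set.ncard_coe_finset]
    exact congrArg Set.ncard (Set.ext fun F => by simp)
  rw [← hc, fVector]
  constructor
  · intro h F hF
    have := Set.eq_of_subset_of_ncard_le (s := {F | F ∈ Δ ∧ F.card = k})
      (t := {F : Finset (Fin n) | F.card = k}) (fun F hF => hF.2) h.ge (Set.toFinite _)
    have hF' : F ∈ {F | F ∈ Δ ∧ F.card = k} := by rw [this]; exact hF
    exact hF'.1
  · intro h
    congr 1
    ext F
    exact ⟨fun hF => hF.2, fun hF => ⟨h F hF, hF⟩⟩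

theorem fVector_eq_zero_iff {Δ : Complex n} {k : ℕ} :
    fVector Δ k = 0 ↔ ∀ F ∈ Δ, F.card ≠ k := by
  rw [fVector, Set.ncard_eq_zero (Set.toFinite _), Set.eq_empty_iff_forall_notMem]
  exact forall_congr' fun F => not_and

theorem fVector_add_fVector_eq_choose {Δ Δ' : Complex n} {k : ℕ}
    (h : ∀ F : Finset (Fin n), F.card = k → (F ∈ Δ' ↔ F ∉ Δ)) :
    fVector Δ k + fVector Δ' k = n.choose k := by
  rw [← (fVector_eq_choose_iff (Δ := ⊤)).mpr fun _ _ => LowerSet.mem_top]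
  unfold fVector
  rw [← Set.ncard_union_eq _ (Set.toFinite _) (Set.toFinite _)]
  · congr 1
    ext F
    have := h F
    simp only [Set.mem_union, Set.mem_ofPred_eq, LowerSet.mem_top, true_and]
    tauto
  · rw [Set.disjoint_left]
    rintro F ⟨hF, hk⟩ ⟨hF', -⟩
    exact (h F hk).mp hF' hF

theorem dim_eq_coe_iff {Δ : Complex n} {m : ℤ} :
    dim Δ = (m : WithBot ℤ) ↔
      (∀ F ∈ Δ, (F.card : ℤ) - 1 ≤ m) ∧ ∃ F ∈ Δ, (F.card : ℤ) - 1 = m := by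
  classical
  unfold dim
  constructor
  · intro h
    refine ⟨fun F hF => ?_, ?_⟩
    · rw [← WithBot.coe_le_coe, ← h]
      exact Finset.le_sup (f := fun F : Finset (Fin n) => (((F.card : ℤ) - 1 : ℤ) : WithBot ℤ))
        (Finset.mem_filter.mpr ⟨Finset.mem_univ _, hF⟩)
    · have hne : (Finset.univ.filter fun F : Finset (Fin n) => F ∈ Δ).Nonempty := by
        rw [Finset.nonempty_iff_ne_empty]
        intro he
        rw [he, Finset.sup_empty] at h
        exact WithBot.bot_ne_coe h
      obtain ⟨F, hF, hs⟩ := Finset.exists_mem_eq_sup _ hne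
        fun F : Finset (Fin n) => (((F.card : ℤ) - 1 : ℤ) : WithBot ℤ)
      rw [hs, WithBot.coe_inj] at h
      exact ⟨F, (Finset.mem_filter.mp hF).2, h⟩
  · rintro ⟨h, F, hF, hm⟩
    refine le_antisymm (Finset.sup_le fun F' hF' => ?_) ?_
    · exact WithBot.coe_le_coe.mpr (h F' (Finset.mem_filter.mp hF').2)
    · rw [← hm]
      exact Finset.le_sup (f := fun F : Finset (Fin n) => (((F.card : ℤ) - 1 : ℤ) : WithBot ℤ))
        (Finset.mem_filter.mpr ⟨Finset.mem_univ _, hF⟩)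

/-- Complementation turns largest faces of the dual into smallest non-faces of `Δ`. -/
theorem dim_alexanderDual_eq_iff {Δ : Complex n} {d : ℕ} :
    dim (alexanderDual Δ) = (((n : ℤ) - (d : ℤ) - 1 : ℤ) : WithBot ℤ) ↔
      (∀ F : Finset (Fin n), F.card < d → F ∈ Δ) ∧ ∃ F ∉ Δ, F.card = d := by
  have hcard (F : Finset (Fin n)) : (Fᶜ.card : ℤ) = n - F.card := by
    have := F.card_compl_add_card
    rw [Fintype.card_fin] at this
    omega
  rw [dim_eq_coe_iff]
  change ((∀ F : Finset (Fin n), Fᶜ ∉ Δ → _) ∧ ∃ F : Finset (Fin n), Fᶜ ∉ Δ ∧ _) ↔ _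
  rw [compl_surjective.forall, compl_surjective.exists]
  simp only [compl_compl, hcard]
  refine and_congr (forall_congr' fun F => ?_) (exists_congr fun F => and_congr_right fun _ => ?_)
  · rw [← not_imp_not, not_not]
    refine imp_congr_left ?_
    omega
  · omega

theorem exists_minimal_nonface {Δ : Complex n} {F : Finset (Fin n)} (hF : F ∉ Δ) :
    ∃ A, A ⊆ F ∧ Minimal (· ∉ Δ) A :=
  (Set.toFinite {F | F ∉ Δ}).exists_le_minimal hF

theorem fVector_generatedBy_minimal_eq_iff {Δ : Complex n} {d : ℕ}
    (hd : ∀ F, Minimal (· ∉ Δ) F → F.card = d) :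
    fVector (generatedBy {F | Minimal (· ∉ Δ) F}) = fVector Δ ↔
      2 * {F | Minimal (· ∉ Δ) F}.ncard = n.choose d ∧
        (∀ F : Finset (Fin n), F.card < d → F ∈ generatedBy {F | Minimal (· ∉ Δ) F}) ∧
        ∀ F ∈ Δ, F.card ≤ d := by
  set Γ := generatedBy {F | Minimal (· ∉ Δ) F} with hΓ
  have hsmall {F : Finset (Fin n)} (hF : F.card < d) : F ∈ Δ := by
    by_contra h
    obtain ⟨A, hAF, hA⟩ := exists_minimal_nonface h
    have := hd A hA
    have := Finset.card_le_card hAF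
    omega
  have hΓle {F : Finset (Fin n)} (hF : F ∈ Γ) : F.card ≤ d := by
    obtain ⟨A, hA, hFA⟩ := hF
    exact (Finset.card_le_card hFA).trans (hd A hA).le
  have hΓd {F : Finset (Fin n)} (hF : F.card = d) : F ∈ Γ ↔ Minimal (· ∉ Δ) F := by
    constructor
    · rintro ⟨A, hA, hFA⟩
      rwa [Finset.eq_of_subset_of_card_le hFA ((hd A hA).le.trans hF.ge)]
    · exact fun h => ⟨F, h, le_rfl⟩
  have hΔd {F : Finset (Fin n)} (hF : F.card = d) : F ∈ Δ ↔ F ∉ Γ := by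
    rw [hΓd hF]
    refine ⟨fun h h' => h'.prop h, fun h => ?_⟩
    by_contra hn
    obtain ⟨A, hAF, hA⟩ := exists_minimal_nonface hn
    rw [Finset.eq_of_subset_of_card_le hAF (hF.le.trans (hd A hA).ge)] at hA
    exact h hA
  have hΓcard : fVector Γ d = {F | Minimal (· ∉ Δ) F}.ncard := by
    unfold fVector
    congr 1
    ext F
    exact ⟨fun h => (hΓd h.2).mp h.1, fun h => ⟨(hΓd (hd F h)).mpr h, hd F h⟩⟩
  have hadd := fVector_add_fVector_eq_choose (k := d) fun F hF => hΔd hF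
  have hzero {k : ℕ} (hk : d < k) : fVector Γ k = 0 :=
    fVector_eq_zero_iff.mpr fun F hF => ((hΓle hF).trans_lt hk).ne
  have hfull {k : ℕ} (hk : k < d) : fVector Δ k = n.choose k :=
    fVector_eq_choose_iff.mpr fun F hF => hsmall (hF.trans_lt hk)
  rw [← hΓcard]
  constructor
  · intro h
    refine ⟨?_, fun F hF => ?_, fun F hF => ?_⟩
    · rw [← hadd, ← h, two_mul]
    · exact fVector_eq_choose_iff.mp ((congrFun h _).trans (hfull hF)) F rfl
    · by_contra! hlt
      exact fVector_eq_zero_iff.mp ((congrFun h _).symm.trans (hzero hlt)) F hF rfl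
  · rintro ⟨h1, h2, h3⟩
    funext k
    rcases lt_trichotomy k d with hk | rfl | hk
    · rw [hfull hk]
      exact fVector_eq_choose_iff.mpr fun F hF => h2 F (hF.trans_lt hk)
    · omega
    · rw [hzero hk]
      exact (fVector_eq_zero_iff.mpr fun F hF => ((h3 F hF).trans_lt hk).ne).symm

theorem equal_fVector_and_pure_iff {Δ : Complex n} {d : ℕ}
    (hd : ∀ F, Minimal (· ∉ Δ) F → F.card = d) :
    (fVector (generatedBy {F | Minimal (· ∉ Δ) F}) = fVector Δ ∧
        ∀ F F', Maximal (· ∈ Δ) F → Maximal (· ∈ Δ) F' → F.card = F'.card) ↔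
      2 * {F | Minimal (· ∉ Δ) F}.ncard = n.choose d ∧
        dim (alexanderDual (generatedBy {F | Minimal (· ∉ Δ) F})) =
          (((n : ℤ) - (d : ℤ) - 1 : ℤ) : WithBot ℤ) ∧
        IsFlag d (generatedBy {F | F.card = d ∧ ¬ Minimal (· ∉ Δ) F}) := by
  rw [fVector_generatedBy_minimal_eq_iff hd, dim_alexanderDual_eq_iff]
  have hface {F : Finset (Fin n)} (hF : F.card = d) : F ∈ Δ ↔ ¬ Minimal (· ∉ Δ) F := by
    refine ⟨fun h h' => h'.prop h, fun h => ?_⟩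
    by_contra hn
    obtain ⟨A, hAF, hA⟩ := exists_minimal_nonface hn
    rw [Finset.eq_of_subset_of_card_le hAF (hF.le.trans (hd A hA).ge)] at hA
    exact h hA
  have hgen (F : Finset (Fin n)) : F ∈ generatedBy {F | F.card = d ∧ ¬ Minimal (· ∉ Δ) F} ↔
      ∃ A ∈ Δ, A.card = d ∧ F ⊆ A := by
    rw [mem_generatedBy]
    refine exists_congr fun A => ⟨?_, ?_⟩
    · rintro ⟨⟨hA, hA'⟩, hFA⟩
      exact ⟨(hface hA).mpr hA', hA, hFA⟩
    · rintro ⟨hA', hA, hFA⟩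
      exact ⟨⟨hA, (hface hA).mp hA'⟩, hFA⟩
  constructor
  · rintro ⟨⟨hcard, hlow, hup⟩, hpure⟩
    obtain ⟨F₀, hF₀, hF₀d⟩ : ∃ F ∈ Δ, F.card = d := by
      by_contra! hno
      have h0 : fVector Δ d = 0 := fVector_eq_zero_iff.mpr hno
      have heq := (fVector_generatedBy_minimal_eq_iff hd).mpr ⟨hcard, hlow, hup⟩
      -- If d > n, the empty set would have to lie in a generator with more than n elements.
      have hle : d ≤ n := by
        by_contra! hlt
        obtain ⟨A, hA, -⟩ := hlow ∅ (by rw [Finset.card_empty]; omega)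
        have := card_finset_fin_le A
        have := hd A hA
        omega
      have hpos := Nat.choose_pos hle
      have hne : {F | Minimal (· ∉ Δ) F}.Nonempty :=
        Set.nonempty_of_ncard_ne_zero (by omega)
      obtain ⟨A, hA⟩ := hne
      exact fVector_eq_zero_iff.mp ((congrFun heq d).trans h0) A ⟨A, hA, le_rfl⟩ (hd A hA)
    have hF₀max : Maximal (· ∈ Δ) F₀ := ⟨hF₀, fun F hF hle =>
      (Finset.eq_of_subset_of_card_le hle ((hup F hF).trans hF₀d.ge)).ge⟩
    refine ⟨hcard, ⟨hlow, F₀, ?_, hF₀d⟩, fun F hF => ?_⟩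
    · rintro ⟨A, hA, hle⟩
      rw [← Finset.eq_of_subset_of_card_le hle ((hd A hA).le.trans hF₀d.ge)] at hA
      exact Minimal.prop (P := (· ∉ Δ)) hA hF₀
    · have hFΔ : F ∉ Δ := by
        intro h
        obtain ⟨F', hFF', hF'⟩ := exists_maximal_ge h
        exact hF.prop ((hgen F).mpr
          ⟨F', hF'.prop, (hpure _ _ hF' hF₀max).trans hF₀d, hFF'⟩)
      obtain ⟨A, hAF, hA⟩ := exists_minimal_nonface hFΔ
      have hAgen : A ∉ generatedBy {F | F.card = d ∧ ¬ Minimal (· ∉ Δ) F} := by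
        rw [hgen]
        rintro ⟨B, hB, -, hAB⟩
        exact hA.prop (Δ.lower hAB hB)
      rw [← hF.eq_of_le hAgen hAF]
      exact hd A hA
  · rintro ⟨hcard, ⟨hlow, -⟩, hflag⟩
    -- Otherwise the flag condition yields a d-subset of `F` outside the generated complex; but it
    -- is a d-face of `Δ`, hence a generator.
    have hmem (F : Finset (Fin n)) (hF : F ∈ Δ) : ∃ A ∈ Δ, A.card = d ∧ F ⊆ A := by
      by_contra hn
      rw [← hgen] at hn
      obtain ⟨A, hAF, hA⟩ := exists_minimal_nonface hn
      exact hA.prop ((hgen A).mpr ⟨A, Δ.lower hAF hF, hflag A hA, le_rfl⟩)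
    have hmax (F : Finset (Fin n)) (hF : Maximal (· ∈ Δ) F) : F.card = d := by
      obtain ⟨A, hA, hAd, hFA⟩ := hmem F hF.prop
      rwa [hF.eq_of_le hA hFA]
    refine ⟨⟨hcard, hlow, fun F hF => ?_⟩, fun F F' hF hF' => (hmax F hF).trans (hmax F' hF').symm⟩
    obtain ⟨A, -, hAd, hFA⟩ := hmem F hF
    exact (Finset.card_le_card hFA).trans hAd.le

end Complexes

end FIdeal

/-! ### Translation back to ideals -/

theorem proposition2p1 {K : Type*} [Field K] (n d : ℕ)
    (I : Ideal (MvPolynomial (Fin n) K)) (hI : FIdeal.IsSqfreeMonomialIdealOfDegree I d) :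
    (FIdeal.IsFIdeal I ∧ FIdeal.IsUnmixed I) ↔
      (((FIdeal.minGens I).ncard : ℚ) = (n.choose d : ℚ) / 2 ∧
        FIdeal.dim (FIdeal.alexanderDual (FIdeal.facetComplex I)) =
          (((n : ℤ) - (d : ℤ) - 1 : ℤ) : WithBot ℤ) ∧
        FIdeal.IsFlag d
          (FIdeal.generatedBy (FIdeal.sigma '' (FIdeal.smDeg n K d \ FIdeal.minGens I)))) := by
  obtain ⟨hI, hdeg⟩ := hI
  have hmin : {A | Minimal (fun A => FIdeal.sqfreeMonomial K A ∈ I) A} =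
      {F | Minimal (· ∉ FIdeal.stanleyReisnerComplex I) F} := by
    simp_rw [FIdeal.mem_stanleyReisnerComplex, not_not]
  have hgens := hI.minGens_eq
  rw [hmin] at hgens
  have hd (F) (hF : Minimal (· ∉ FIdeal.stanleyReisnerComplex I) F) : F.card = d := by
    rw [← FIdeal.totalDegree_sqfreeMonomial (K := K) F]
    exact hdeg _ (hgens ▸ Set.mem_image_of_mem _ hF)
  rw [FIdeal.IsFIdeal, FIdeal.facetComplex, hI.isUnmixed_iff, FIdeal.smDeg_eq, hgens,
    ← Set.image_sdiff FIdeal.sqfreeMonomial_injective, FIdeal.sigma_image_sqfreeMonomial_image,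
    FIdeal.sigma_image_sqfreeMonomial_image,
    Set.ncard_image_of_injective _ FIdeal.sqfreeMonomial_injective,
    FIdeal.equal_fVector_and_pure_iff hd]
  refine and_congr ?_ Iff.rfl
  rw [eq_div_iff two_ne_zero, mul_comm]
  norm_cast
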